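/- A parity automaton with costs $\mathcal{A} = (Q, \Sigma, q_I, \delta, \Omega, \mathrm{Cst})$ consists of a finite set $Q$ of states, an alphabet $\Sigma$, an initial state $q_I \in Q$, a transition function $\delta \colon Q \times \Sigma \to Q$, a coloring $\Omega \colon Q \to \mathbb{N}$, and a cost function $\mathrm{Cst}$ that declares every transition $(q, a, \delta(q,a))$ to be either an $\varepsilon$-transition or an increment-transition. Let $\rho = (q_0,a_0,q_1)(q_1,a_1,q_2)\cdots$ with $q_0 = q_I$ and $q_{j+1} = \delta(q_j,a_j)$ be the run of $\mathcal{A}$ on an infinite word $a_0a_1a_2\cdots$. The cost of a finite infix of $\rho$ is the number of increment-transitions in it. The cost-of-response $\mathrm{Cor}(\rho,m)$ is $0$ if $\Omega(q_m)$ is even. If $\Omega(q_m)$ is odd, it is the minimal cost of an infix $(q_m,a_m,q_{m+1})\cdots(q_{m'-1},a_{m'-1},q_{m'})$ with $m' > m$ such that $\Omega(q_{m'})$ is even and $\Omega(q_{m'}) > \Omega(q_m)$, and $\infty$ if there is no such $m'$. The language $L(\mathcal{A})$ is the set of all infinite words whose run $\rho$ satisfies $\limsup_{m\to\infty} \mathrm{Cor}(\rho,m)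 < \infty$. A delay function is a map $f \colon \mathbb{N} \to \mathbb{N}\setminus\{0\}$; it is constant if $f(i) = 1$ for every $i > 0$. For $L \subseteq (\Sigma_I \times \Sigma_O)^\omega$, the delay game $\Gamma_f(L)$ is played in rounds $i = 0,1,2,\ldots$: in round $i$, first Player $I$ picks a word $u_i \in \Sigma_I^{f(i)}$, then Player $O$ picks a letter $v_i \in \Sigma_O$. Player $O$ wins the play if the infinite word whose first components form $u_0u_1u_2\cdots$ and whose second components form $v_0v_1v_2\cdots$ is in $L$; otherwise Player $I$ wins it. A strategy for Player $I$ is a map $\tau \colon \Sigma_O^* \to \Sigma_I^*$ with $|\tau(w)| = f(|w|)$; a play is consistent with $\tau$ if $u_i = \tau(v_0\cdots v_{i-1})$ for every $i$. Player $I$ wins $\Gamma_f(L)$ if he has a strategy such that he wins every play consistent with it. **Theorem.** Let $\mathcal{A}$ be a parity automaton with costs over the alphabet $\Sigma_I \times \Sigma_O$ with $n = |Q|$ states and $k = |\Omega(Q)|$ colors, and let $f$ be the constant delay function with $f(0) = 2^{2n^4k^2+1}$. The following are equivalent: 1. Player $I$ wins $\Gamma_f(L(\mathcal{A}))$. 2.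 Player $I$ wins $\Gamma_{f'}(L(\mathcal{A}))$ for every delay function $f'$. -/

import Mathlib

/-- The two possible costs of a transition: `eps` for an ε-transition, `inc` for an
increment-transition. -/
inductive TransitionCost where
  | eps
  | inc
  deriving DecidableEq

/-- A deterministic and complete parity automaton with costs, with state set `Q` and alphabet `Alph`.
As the transition function is deterministic and complete, a transition `(q, a, step q a)` is given
by the pair `(q, a)`, so the cost function is a function of `q` and `a`.
Finiteness of `Q` is required where automata are used, by `[Finite Q]`. -/
structure ParityAutomatonWithCosts (Q Alph : Type*) where
  init : Q
  step : Q → Alph → Q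
  color : Q → ℕ
  cost : Q → Alph → TransitionCost

namespace ParityAutomatonWithCosts

variable {Q Alph : Type*} (A : ParityAutomatonWithCosts Q Alph)

/-- The `n`-th state `q_n` of the run of `A` on the infinite word `w` (starting in `init`). -/
def state (w : ℕ → Alph) : ℕ → Q
  | 0 => A.init
  | n + 1 => A.step (state w n) (w n)

/-- The cost of the infix `(q_n, a_n, q_{n+1}) ⋯ (q_{n'-1}, a_{n'-1}, q_{n'})` of the run of `A` on
`w`: the number of increment-transitions in it. -/
def infixCost (w : ℕ → Alph) (n n' : ℕ) : ℕ :=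
  ((Finset.Ico n n').filter fun j => A.cost (A.state w j) (w j) = TransitionCost.inc).card

/-- The colors of `A` that answer a request of color `c`. -/
def answer (c : ℕ) : Set ℕ :=
  {c' | c' ∈ Set.range A.color ∧ c < c' ∧ Even c'}

open Classical in
/-- The cost-of-response at position `n` of the run of `A` on `w`. It is `0` at an even color; at an
odd color it is the minimal cost of reaching an answer, and `⊤` if there is no later answer. -/
noncomputable def costOfResponse (w : ℕ → Alph) (n : ℕ) : ℕ∞ :=
  if Even (A.color (A.state w n)) then 0
  else ⨅ n' ∈ {n' : ℕ | n < n' ∧ A.color (A.state w n') ∈ A.answer (A.color (A.state w n))},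
    (A.infixCost w n n' : ℕ∞)

/-- The cost of the run of `A` on `w`. -/
noncomputable def runCost (w : ℕ → Alph) : ℕ∞ :=
  Filter.limsup (A.costOfResponse w) Filter.atTop

/-- The language of `A`: all infinite words on which the run of `A` has finite cost. -/
def language : Set (ℕ → Alph) :=
  {w | A.runCost w < ⊤}

/-- The number of states. -/
noncomputable def numStates (_A : ParityAutomatonWithCosts Q Alph) : ℕ := Nat.card Q

/-- The number of colors that occur on states of `A`. -/
noncomputable def numColors : ℕ := (Set.range A.color).ncard

end ParityAutomatonWithCosts

/-- A delay function maps every round to the positive number of letters that Player I has to pick in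
that round. -/
structure DelayFunction where
  toFun : ℕ → ℕ
  pos : ∀ i, 0 < toFun i

/-- A delay function is constant if it is `1` in every round but the first. -/
def DelayFunction.IsConstant (f : DelayFunction) : Prop :=
  ∀ i, 0 < i → f.toFun i = 1

theorem lt_length_flatMap_range {α : Type*} (u : ℕ → List α) (hu : ∀ i, 0 < (u i).length) (m : ℕ) :
    m < ((List.range (m + 1)).flatMap u).length := by
  induction m with
  | zero => simpa using hu 0
  | succ m ih =>
    rw [List.range_succ, List.flatMap_append, List.length_append]
    have h := hu (m + 1)
    simp only [List.flatMap_singleton]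
    omega

/-- The infinite concatenation `u 0 ++ u 1 ++ u 2 ++ ⋯` of non-empty finite words. Its letter at
position `m` is the one of `u 0 ++ ⋯ ++ u m`, which has more than `m` letters. -/
def infiniteConcat {α : Type*} (u : ℕ → List α) (hu : ∀ i, 0 < (u i).length) (m : ℕ) : α :=
  ((List.range (m + 1)).flatMap u)[m]'(lt_length_flatMap_range u hu m)

namespace DelayGame

variable {AlphI AlphO : Type*} {f : DelayFunction}

/-- A play `(u 0, v 0) (u 1, v 1) ⋯` of a delay game with delay function `f`: in round `i`,
Player I picks the word `u i` of length `f i`, then Player O picks the letter `v i`. -/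
structure Play (AlphI AlphO : Type*) (f : DelayFunction) where
  u : ℕ → List AlphI
  length_u : ∀ i, (u i).length = f.toFun i
  v : ℕ → AlphO

/-- The outcome of a play, an infinite word over `AlphI × AlphO`. -/
def Play.outcome (p : Play AlphI AlphO f) : ℕ → AlphI × AlphO := fun m =>
  (infiniteConcat p.u (fun i => (p.length_u i).symm ▸ f.pos i) m, p.v m)

/-- A strategy for Player I, which maps the moves of Player O made so far to a word of the
required length. -/
structure StrategyI (AlphI AlphO : Type*) (f : DelayFunction) where
  toFun : List AlphO → List AlphI
  length_toFun : ∀ w, (toFun w).length = f.toFun w.length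

/-- A play is consistent with a strategy for Player I if `u i` is the answer of the strategy to
`v 0 ⋯ v (i - 1)`, for every `i`. -/
def Play.ConsistentWith (p : Play AlphI AlphO f) (τ : StrategyI AlphI AlphO f) : Prop :=
  ∀ i, p.u i = τ.toFun ((List.range i).map p.v)

/-- A strategy for Player I is winning for the winning condition `L` if the outcome of no
consistent play is in `L`. -/
def StrategyI.IsWinning (τ : StrategyI AlphI AlphO f) (L : Set (ℕ → AlphI × AlphO)) : Prop :=
  ∀ p : Play AlphI AlphO f, p.ConsistentWith τ → p.outcome ∉ L

/-- Player I wins the delay game with delay function `f` and winning condition `L` (for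
Player O). -/
def PlayerIWins (f : DelayFunction) (L : Set (ℕ → AlphI × AlphO)) : Prop :=
  ∃ τ : StrategyI AlphI AlphO f, τ.IsWinning L

end DelayGame

/-! Only the passage from the constant delay function to an arbitrary `f'` needs work. A finite
infix of a run is abstracted to a record: its last state, its best answer, its largest open request,
and whether it contains an increment. If two runs split into blocks with equal records and the
blocks of the first have fixed length `N`, then acceptance of the second implies acceptance of the
first: a costly block of length `N` costs at most `N`, while its counterpart costs at least 1
(`mem_language_of_runRecord_eq`).

A word of Player I is abstracted to the set of pairs of a first state and a record that Player O can
realize on it. There are `2 ^ (2 * n ^ 4)` such sets, and the abstraction is a right congruence, so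
a word of at least that length can be pumped without changing its set (`exists_long_choices_eq`).

Player I wins with `f'` by simulating a play won by the given strategy. Each simulated block of
length `N` is replaced by an equivalent word long enough for `f'`, and Player O's answer to it is
translated back into an answer on the short block with the same record. If the actual outcome were
accepted, so would be the simulated one. A lookahead of two blocks lets Player I know the next block
before the answer to the current one is complete. -/

/-- The number of letters Player I has picked after round `j`. -/
def DelayFunction.total (f : DelayFunction) (j : ℕ) : ℕ := ∑ i ∈ Finset.range (j + 1), f.toFun i

theorem DelayFunction.total_strictMono (f : DelayFunction) : StrictMono f.total := by
  refine strictMono_nat_of_lt_succ fun j => ?_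
  unfold DelayFunction.total
  rw [Finset.sum_range_succ _ (j + 1)]
  have := f.pos (j + 1)
  omega

theorem DelayFunction.lt_total (f : DelayFunction) (j : ℕ) : j < f.total j := by
  induction j with
  | zero => simpa [DelayFunction.total] using f.pos 0
  | succ j ih =>
    have := f.total_strictMono (show j < j + 1 by omega)
    omega

theorem DelayFunction.total_of_isConstant (f : DelayFunction) (hf : f.IsConstant) (j : ℕ) :
    f.total j = f.toFun 0 + j := by
  induction j with
  | zero => simp [DelayFunction.total]
  | succ j ih =>
    unfold DelayFunction.total at ih ⊢
    rw [Finset.sum_range_succ, ih, hf (j + 1) (by omega)]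
    omega

theorem length_flatMap_range_eq_sum {α : Type*} (u : ℕ → List α) (j : ℕ) :
    ((List.range j).flatMap u).length = ∑ i ∈ Finset.range j, (u i).length := by
  induction j with
  | zero => simp
  | succ j ih => rw [List.range_succ, Finset.sum_range_succ]; simp [← ih]

theorem flatMap_range_prefix {α : Type*} (u : ℕ → List α) {j j' : ℕ} (h : j ≤ j') :
    (List.range j).flatMap u <+: (List.range j').flatMap u := by
  obtain ⟨d, rfl⟩ := Nat.exists_eq_add_of_le h
  rw [List.range_add, List.flatMap_append]
  exact List.prefix_append _ _

theorem infiniteConcat_eq_getElem {α : Type*} (u : ℕ → List α) (hu : ∀ i, 0 < (u i).length)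
    (j m : ℕ) (h : m < ((List.range j).flatMap u).length) :
    infiniteConcat u hu m = ((List.range j).flatMap u)[m] := by
  unfold infiniteConcat
  rcases le_total (m + 1) j with h' | h'
  · exact (flatMap_range_prefix u h').getElem _
  · exact ((flatMap_range_prefix u h').getElem h).symm

/-- The finite word `w`, continued by `d` forever. -/
def extendWord {α : Type*} (d : α) (w : List α) (i : ℕ) : α := w.getD i d

theorem extendWord_map_range {α : Type*} (d : α) (v : ℕ → α) {i j : ℕ} (h : i < j) :
    extendWord d ((List.range j).map v) i = v i := by
  simp [extendWord, h]

/-! ### Strategies of Player I as causal maps -/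

namespace DelayGame

variable {AlphI AlphO : Type*}

/-- The first `f 0 + ⋯ + f j` letters of `g v` depend on the first `j` letters of `v` only. -/
def IsCausal (f : DelayFunction) (g : (ℕ → AlphO) → ℕ → AlphI) : Prop :=
  ∀ v v' j m, (∀ i < j, v i = v' i) → m < f.total j → g v m = g v' m

theorem PlayerIWins.exists_isCausal {f : DelayFunction} {L : Set (ℕ → AlphI × AlphO)}
    (h : PlayerIWins f L) :
    ∃ g : (ℕ → AlphO) → ℕ → AlphI, IsCausal f g ∧ ∀ v, (fun m => (g v m, v m)) ∉ L := by
  obtain ⟨τ, hτ⟩ := h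
  let p : (ℕ → AlphO) → Play AlphI AlphO f := fun v =>
    { u := fun i => τ.toFun ((List.range i).map v)
      length_u := fun i => by simpa using τ.length_toFun ((List.range i).map v)
      v := v }
  have hlen : ∀ v j, ((List.range (j + 1)).flatMap (p v).u).length = f.total j := fun v j => by
    rw [length_flatMap_range_eq_sum]
    exact Finset.sum_congr rfl fun i _ => (p v).length_u i
  refine ⟨fun v m => ((p v).outcome m).1, fun v v' j m hv hm => ?_, fun v => ?_⟩
  · have hu : (List.range (j + 1)).flatMap (p v).u = (List.range (j + 1)).flatMap (p v').u := by
      refine List.flatMap_congr fun i hi => congrArg τ.toFun (List.map_congr_left fun l hl => ?_)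
      rw [List.mem_range] at hi hl
      exact hv l (by omega)
    simp only [Play.outcome]
    rw [infiniteConcat_eq_getElem _ _ (j + 1) m (by rwa [hlen]),
      infiniteConcat_eq_getElem _ _ (j + 1) m (by rwa [hlen])]
    simp only [hu]
  · exact hτ (p v) fun i => rfl

/-- Converse of `PlayerIWins.exists_isCausal`. By causality, the padding letter `d` does not
influence the letters that have to be picked. -/
theorem IsCausal.playerIWins {f : DelayFunction} {L : Set (ℕ → AlphI × AlphO)} (d : AlphO)
    {g : (ℕ → AlphO) → ℕ → AlphI} (hg : IsCausal f g) (hL : ∀ v, (fun m => (g v m, v m)) ∉ L) :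
    PlayerIWins f L := by
  let τ : StrategyI AlphI AlphO f :=
    { toFun := fun w => (List.range (f.toFun w.length)).map fun l =>
        g (extendWord d w) (∑ i ∈ Finset.range w.length, f.toFun i + l)
      length_toFun := fun w => by simp }
  refine ⟨τ, fun p hp => ?_⟩
  have hu : ∀ i, p.u i = (List.range (f.toFun i)).map fun l =>
      g p.v (∑ i ∈ Finset.range i, f.toFun i + l) := fun i => by
    rw [hp i]
    simp only [τ, List.length_map, List.length_range]
    refine List.map_congr_left fun l hl => hg _ _ i _ (fun l hl => extendWord_map_range d _ hl) ?_
    rw [List.mem_range] at hl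
    unfold DelayFunction.total
    rw [Finset.sum_range_succ]
    omega
  have hflat : ∀ j, (List.range j).flatMap p.u =
      (List.range (∑ i ∈ Finset.range j, f.toFun i)).map (g p.v) := fun j => by
    induction j with
    | zero => simp
    | succ j ih =>
      rw [List.range_succ, List.flatMap_append, ih, Finset.sum_range_succ, List.range_add]
      simp [hu, Function.comp_def]
  have hout : p.outcome = fun m => (g p.v m, p.v m) := by
    funext m
    simp only [Play.outcome, infiniteConcat, hflat]
    simp
  exact hout ▸ hL p.v

theorem playerIWins_of_isEmpty [IsEmpty AlphO] {f : DelayFunction} {L : Set (ℕ → AlphI × AlphO)}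
    (d : AlphI) : PlayerIWins f L :=
  ⟨⟨fun w => List.replicate (f.toFun w.length) d, fun w => by simp⟩, fun p => isEmptyElim (p.v 0)⟩

end DelayGame

/-! ### Records of finite infixes -/

/-- A color, as a request: `0` if it is not odd. -/
def requestColor (c : ℕ) : ℕ := if Odd c then c else 0

/-- A color, as an answer: `0` if it is not even. -/
def answerColor (c : ℕ) : ℕ := if Even c then c else 0

/-- What is recorded about a finite infix of a run. -/
structure InfixRecord (Q : Type*) where
  /-- the last state -/
  last : Q
  /-- a state with the largest even color -/
  best : Q
  /-- a state with the largest request that is open at the end -/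
  pending : Q
  /-- whether there is an increment-transition -/
  costly : Bool

namespace InfixRecord

variable {Q : Type*}

/-- An infix record as a tuple. -/
def equivProd : InfixRecord Q ≃ Q × Q × Q × Bool where
  toFun r := (r.last, r.best, r.pending, r.costly)
  invFun r := ⟨r.1, r.2.1, r.2.2.1, r.2.2.2⟩
  left_inv _ := rfl
  right_inv _ := rfl

end InfixRecord

namespace ParityAutomatonWithCosts

variable {Q Alph : Type*} (A : ParityAutomatonWithCosts Q Alph)

theorem mem_language_iff (w : ℕ → Alph) :
    w ∈ A.language ↔ ∃ b M : ℕ, ∀ m ≥ M, Odd (A.color (A.state w m)) →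
      ∃ m' > m, Even (A.color (A.state w m')) ∧ A.color (A.state w m) < A.color (A.state w m') ∧
        A.infixCost w m m' ≤ b := by
  have key : ∀ (b m : ℕ), A.costOfResponse w m ≤ b ↔ (Odd (A.color (A.state w m)) →
      ∃ m' > m, Even (A.color (A.state w m')) ∧ A.color (A.state w m) < A.color (A.state w m') ∧
        A.infixCost w m m' ≤ b) := by
    intro b m
    unfold costOfResponse
    split_ifs with h
    · simp [Nat.not_odd_iff_even.mpr h]
    · simp only [Nat.not_even_iff_odd.mp h, true_imp_iff]
      constructor
      · intro hb
        -- The strict bound `b + 1` extracts a witness without showing that the infimum is attained.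
        have hb' := lt_of_le_of_lt hb (ENat.natCast_lt_natCast.mpr (Nat.lt_succ_self b))
        simp only [iInf_lt_iff] at hb'
        obtain ⟨m', ⟨h1, h2⟩, h3⟩ := hb'
        exact ⟨m', h1, h2.2.2, h2.2.1, Nat.lt_succ_iff.mp (ENat.natCast_lt_natCast.mp h3)⟩
      · rintro ⟨m', h1, h2, h3, h4⟩
        exact (iInf₂_le m' ⟨h1, ⟨_, rfl⟩, h3, h2⟩).trans (by exact_mod_cast h4)
  constructor
  · intro h
    have h' : A.runCost w < ⊤ := h
    rw [runCost, Filter.limsup_eq, sInf_lt_iff] at h'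
    obtain ⟨a, ha, hlt⟩ := h'
    lift a to ℕ using hlt.ne
    obtain ⟨M, hM⟩ := Filter.eventually_atTop.mp ha
    exact ⟨a, M, fun m hm => (key a m).mp (hM m hm)⟩
  · rintro ⟨b, M, h⟩
    change A.runCost w < ⊤
    rw [runCost, Filter.limsup_eq]
    refine lt_of_le_of_lt (sInf_le (a := (b : ℕ∞)) ?_) (ENat.natCast_lt_top b)
    exact Filter.eventually_atTop.mpr ⟨M, fun m hm => (key b m).mpr (h m hm)⟩

open Classical in
/-- The record after one more transition. -/
noncomputable def recordStep (r : InfixRecord Q) (a : Alph) : InfixRecord Q :=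
  let q := A.step r.last a
  { last := q
    best := if answerColor (A.color r.best) < answerColor (A.color q) then q else r.best
    pending := if requestColor (A.color r.pending) < A.color q then q else r.pending
    costly := r.costly || decide (A.cost r.last a = TransitionCost.inc) }

/-- The record of the infix from `q` on the finite word `x`. -/
noncomputable def record (q : Q) (x : List Alph) : InfixRecord Q :=
  x.foldl A.recordStep ⟨q, q, q, false⟩

/-- The infix of length `l` from position `s` of `w`. -/
def infixWord (w : ℕ → Alph) (s l : ℕ) : List Alph := (List.range l).map fun i => w (s + i)

theorem infixWord_succ (w : ℕ → Alph) (s l : ℕ) :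
    infixWord w s (l + 1) = infixWord w s l ++ [w (s + l)] := by
  simp [infixWord, List.range_succ]

/-- The record of the infix of length `l` from position `s` of the run on `w`. -/
noncomputable def runRecord (w : ℕ → Alph) (s l : ℕ) : InfixRecord Q :=
  A.record (A.state w s) (infixWord w s l)

theorem runRecord_zero (w : ℕ → Alph) (s : ℕ) :
    A.runRecord w s 0 = ⟨A.state w s, A.state w s, A.state w s, false⟩ := rfl

theorem runRecord_succ (w : ℕ → Alph) (s l : ℕ) :
    A.runRecord w s (l + 1) = A.recordStep (A.runRecord w s l) (w (s + l)) := by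
  simp [runRecord, infixWord_succ, record]

theorem last_runRecord (w : ℕ → Alph) (s l : ℕ) :
    (A.runRecord w s l).last = A.state w (s + l) := by
  induction l with
  | zero => rfl
  | succ l ih => simp [runRecord_succ, recordStep, ih, state]

theorem costly_runRecord (w : ℕ → Alph) (s l : ℕ) :
    (A.runRecord w s l).costly = true ↔
      ∃ i < l, A.cost (A.state w (s + i)) (w (s + i)) = TransitionCost.inc := by
  induction l with
  | zero => simp [runRecord_zero]
  | succ l ih =>
    simp only [runRecord_succ, recordStep, Bool.or_eq_true, ih, decide_eq_true_eq, last_runRecord,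
      Nat.lt_succ_iff_lt_or_eq]
    grind

theorem exists_state_eq_best_runRecord (w : ℕ → Alph) (s l : ℕ) :
    ∃ i ≤ l, A.state w (s + i) = (A.runRecord w s l).best := by
  induction l with
  | zero => exact ⟨0, le_rfl, rfl⟩
  | succ l ih =>
    obtain ⟨i, hi, h⟩ := ih
    simp only [runRecord_succ, recordStep]
    split_ifs
    · exact ⟨l + 1, le_rfl, by rw [last_runRecord]; rfl⟩
    · exact ⟨i, by omega, h⟩

theorem answerColor_le_best_runRecord (w : ℕ → Alph) (s l i : ℕ) (hi : i ≤ l) :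
    answerColor (A.color (A.state w (s + i))) ≤
      answerColor (A.color (A.runRecord w s l).best) := by
  induction l with
  | zero => obtain rfl : i = 0 := by omega
            exact le_rfl
  | succ l ih =>
    have hq : A.step (A.runRecord w s l).last (w (s + l)) = A.state w (s + (l + 1)) := by
      rw [last_runRecord]; rfl
    simp only [runRecord_succ, recordStep, hq]
    rcases Nat.lt_or_ge l i with h | h
    · obtain rfl : i = l + 1 := by omega
      split_ifs <;> omega
    · have := ih h
      split_ifs <;> omega

/-- Tracking the largest open request suffices: the pending value drops only at a larger even color,
which answers every open request at once. -/
theorem answered_or_le_pending_runRecord (w : ℕ → Alph) (s l i : ℕ) (hi : i ≤ l)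
    (hodd : Odd (A.color (A.state w (s + i)))) :
    (∃ j ≤ l, i < j ∧ Even (A.color (A.state w (s + j))) ∧
      A.color (A.state w (s + i)) < A.color (A.state w (s + j))) ∨
    A.color (A.state w (s + i)) ≤ requestColor (A.color (A.runRecord w s l).pending) := by
  induction l with
  | zero => obtain rfl : i = 0 := by omega
            right
            simp only [add_zero] at hodd
            simp [runRecord_zero, requestColor, hodd]
  | succ l ih =>
    have hq : A.step (A.runRecord w s l).last (w (s + l)) = A.state w (s + (l + 1)) := by
      rw [last_runRecord]; rfl
    simp only [runRecord_succ, recordStep, hq]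
    rcases Nat.lt_or_ge l i with h | h
    · obtain rfl : i = l + 1 := by omega
      right
      split_ifs with hc
      · simp [requestColor, hodd]
      · omega
    · rcases ih h with ⟨j, hj, h1⟩ | h1
      · exact Or.inl ⟨j, by omega, h1⟩
      · split_ifs with hc
        · rcases Nat.even_or_odd (A.color (A.state w (s + (l + 1)))) with he | ho
          · exact Or.inl ⟨l + 1, le_rfl, by omega, he, by omega⟩
          · right
            rw [requestColor, if_pos ho]
            omega
        · exact Or.inr h1

theorem exists_state_eq_pending_runRecord (w : ℕ → Alph) (s l : ℕ)
    (hodd : Odd (A.color (A.runRecord w s l).pending)) :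
    ∃ i ≤ l, A.state w (s + i) = (A.runRecord w s l).pending ∧
      ∀ j ≤ l, i < j → Even (A.color (A.state w (s + j))) →
        ¬ A.color (A.state w (s + i)) < A.color (A.state w (s + j)) := by
  induction l with
  | zero => exact ⟨0, le_rfl, rfl, fun j hj hj' => by omega⟩
  | succ l ih =>
    have hq : A.step (A.runRecord w s l).last (w (s + l)) = A.state w (s + (l + 1)) := by
      rw [last_runRecord]; rfl
    simp only [runRecord_succ, recordStep, hq] at hodd ⊢
    split_ifs at hodd ⊢ with hc
    · exact ⟨l + 1, le_rfl, rfl, fun j hj hj' => by omega⟩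
    · obtain ⟨i, hi, h1, h2⟩ := ih hodd
      refine ⟨i, by omega, h1, fun j hj hij he => ?_⟩
      rcases Nat.lt_or_ge l j with h | h
      · obtain rfl : j = l + 1 := by omega
        rw [requestColor, if_pos hodd] at hc
        rwa [h1]
      · exact h2 j h hij he

/-! ### Costs, and transfer of acceptance between runs with equal block records -/

theorem infixCost_eq_sum (w : ℕ → Alph) (s s' : ℕ) :
    A.infixCost w s s' = ∑ j ∈ Finset.Ico s s',
      if A.cost (A.state w j) (w j) = TransitionCost.inc then 1 else 0 := by
  rw [infixCost, Finset.card_filter]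

theorem infixCost_mono (w : ℕ → Alph) {s s' r r' : ℕ} (h : r ≤ s) (h' : s' ≤ r') :
    A.infixCost w s s' ≤ A.infixCost w r r' :=
  Finset.card_le_card (Finset.filter_subset_filter _ (Finset.Ico_subset_Ico h h'))

theorem infixCost_le (w : ℕ → Alph) (s s' : ℕ) : A.infixCost w s s' ≤ s' - s :=
  (Finset.card_filter_le _ _).trans (by simp)

theorem infixCost_add (w : ℕ → Alph) {s s' s'' : ℕ} (h : s ≤ s') (h' : s' ≤ s'') :
    A.infixCost w s s' + A.infixCost w s' s'' = A.infixCost w s s'' := by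
  simp only [infixCost_eq_sum]
  exact Finset.sum_Ico_consecutive _ h h'

theorem infixCost_pos_iff (w : ℕ → Alph) (s l : ℕ) :
    0 < A.infixCost w s (s + l) ↔ (A.runRecord w s l).costly = true := by
  rw [costly_runRecord, infixCost, Finset.card_pos]
  constructor
  · rintro ⟨j, hj⟩
    rw [Finset.mem_filter, Finset.mem_Ico] at hj
    obtain ⟨i, rfl⟩ := Nat.exists_eq_add_of_le hj.1.1
    exact ⟨i, by omega, hj.2⟩
  · rintro ⟨i, hi, h⟩
    exact ⟨s + i, by rw [Finset.mem_filter, Finset.mem_Ico]; exact ⟨by omega, h⟩⟩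

variable {w w' : ℕ → Alph} {N : ℕ} {t : ℕ → ℕ}

/-- Blockwise: a block of `w` with positive cost costs at most its length `N`, and the equal record
forces an increment in the matching block of `w'`. -/
theorem infixCost_le_mul_infixCost (ht : StrictMono t)
    (h : ∀ i, A.runRecord w (i * N) N = A.runRecord w' (t i) (t (i + 1) - t i)) (i d : ℕ) :
    A.infixCost w (i * N) ((i + d) * N) ≤ N * A.infixCost w' (t i) (t (i + d)) := by
  induction d with
  | zero => simp [infixCost]
  | succ d ih =>
    have hlt : t (i + d) < t (i + d + 1) := ht (by omega)
    have hle : t i ≤ t (i + d) := ht.monotone (by omega)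
    have e1 := A.infixCost_add w (s := i * N) (s' := (i + d) * N) (s'' := (i + d + 1) * N)
      (Nat.mul_le_mul_right _ (by omega)) (Nat.mul_le_mul_right _ (by omega))
    have e2 := A.infixCost_add w' hle hlt.le
    have hb : A.infixCost w ((i + d) * N) ((i + d + 1) * N) ≤
        N * A.infixCost w' (t (i + d)) (t (i + d + 1)) := by
      rcases Nat.eq_zero_or_pos (A.infixCost w ((i + d) * N) ((i + d + 1) * N)) with h0 | h0
      · omega
      · have h1 : 0 < A.infixCost w' (t (i + d)) (t (i + d + 1)) := by
          have e := (A.infixCost_pos_iff w' (t (i + d)) (t (i + d + 1) - t (i + d))).mpr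
          rw [Nat.add_sub_cancel' hlt.le, ← h (i + d), ← infixCost_pos_iff] at e
          exact e (by rwa [← Nat.succ_mul])
        have h2 := A.infixCost_le w ((i + d) * N) ((i + d + 1) * N)
        rw [Nat.succ_mul, Nat.add_sub_cancel_left] at h2
        rw [Nat.succ_mul]
        exact h2.trans (Nat.le_mul_of_pos_right _ h1)
    rw [← add_assoc, ← e1, ← e2, mul_add]
    exact add_le_add ih hb

theorem mem_language_of_runRecord_eq (hN : 0 < N) (ht : StrictMono t)
    (h : ∀ i, A.runRecord w (i * N) N = A.runRecord w' (t i) (t (i + 1) - t i))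
    (hw' : w' ∈ A.language) : w ∈ A.language := by
  rw [mem_language_iff] at hw' ⊢
  obtain ⟨b, M, hb⟩ := hw'
  -- `N` for the rest of the requesting block, `N * b` for the full blocks in between, `N` for the
  -- answering block.
  refine ⟨N * b + 2 * N, M * N, fun m hm hodd => ?_⟩
  obtain ⟨i, l, hl, rfl⟩ : ∃ i l, l < N ∧ m = i * N + l :=
    ⟨m / N, m % N, Nat.mod_lt _ hN, (Nat.div_add_mod' m N).symm⟩
  have hMi : M ≤ i := by
    by_contra hlt
    have : (i + 1) * N ≤ M * N := Nat.mul_le_mul_right _ (by omega)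
    rw [Nat.succ_mul] at this
    omega
  rcases A.answered_or_le_pending_runRecord w (i * N) N l hl.le hodd with ⟨j, hj, hlj, he, hc⟩ | hc
  · exact ⟨i * N + j, by omega, he, hc, (A.infixCost_le _ _ _).trans (by omega)⟩
  · have hpos : 0 < A.color (A.state w (i * N + l)) := hodd.pos
    have hodd' : Odd (A.color (A.runRecord w (i * N) N).pending) := by
      by_contra hne
      rw [requestColor, if_neg hne] at hc
      omega
    rw [requestColor, if_pos hodd', h i] at hc
    rw [h i] at hodd'
    obtain ⟨r, hr, hr1, hr2⟩ := A.exists_state_eq_pending_runRecord w' _ _ hodd'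
    have hti : t i < t (i + 1) := ht (by omega)
    have hiti : i ≤ t i := ht.le_apply
    rw [← hr1] at hodd' hc
    obtain ⟨m', hm', he, hlt, hcost⟩ := hb (t i + r) (by omega) hodd'
    -- The inequality is strict because a block includes both of its boundary states.
    have hm't : t (i + 1) < m' := by
      by_contra hle
      obtain ⟨j, rfl⟩ := Nat.exists_eq_add_of_le (show t i ≤ m' by omega)
      exact hr2 j (by omega) (by omega) he hlt
    obtain ⟨d, hd1, hd2⟩ : ∃ d, t (i + 1 + d) ≤ m' ∧ m' ≤ t (i + 1 + d + 1) := by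
      have hex : ∃ d, m' ≤ t (i + 1 + d + 1) := ⟨m', le_trans (by omega) ht.le_apply⟩
      refine ⟨Nat.find hex, ?_, Nat.find_spec hex⟩
      rcases hf : Nat.find hex with _ | d
      · exact hm't.le
      · have := Nat.find_min hex (m := d) (by omega)
        rw [← add_assoc]
        omega
    have hbest := A.answerColor_le_best_runRecord w' (t (i + 1 + d))
      (t (i + 1 + d + 1) - t (i + 1 + d)) (m' - t (i + 1 + d)) (by omega)
    rw [Nat.add_sub_cancel' hd1, ← h (i + 1 + d), answerColor, if_pos he] at hbest
    obtain ⟨p, hp, hp1⟩ := A.exists_state_eq_best_runRecord w ((i + 1 + d) * N) N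
    rw [← hp1] at hbest
    have hev : Even (A.color (A.state w ((i + 1 + d) * N + p))) := by
      by_contra hne
      rw [answerColor, if_neg hne] at hbest
      omega
    rw [answerColor, if_pos hev] at hbest
    have e1 : (i + 1) * N = i * N + N := Nat.succ_mul _ _
    have e2 : (i + 1) * N ≤ (i + 1 + d) * N := Nat.mul_le_mul_right _ (by omega)
    refine ⟨(i + 1 + d) * N + p, by omega, hev, by omega, ?_⟩
    have c1 := A.infixCost_add w (s := i * N + l) (s' := (i + 1) * N)
      (s'' := (i + 1 + d) * N + p) (by omega) (by omega)
    have c2 := A.infixCost_add w (s := (i + 1) * N) (s' := (i + 1 + d) * N)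
      (s'' := (i + 1 + d) * N + p) e2 (by omega)
    have c3 := A.infixCost_le w (i * N + l) ((i + 1) * N)
    have c4 := A.infixCost_le w ((i + 1 + d) * N) ((i + 1 + d) * N + p)
    have c5 := A.infixCost_le_mul_infixCost ht h (i + 1) d
    have c6 : N * A.infixCost w' (t (i + 1)) (t (i + 1 + d)) ≤ N * b :=
      Nat.mul_le_mul_left _ ((A.infixCost_mono w' (by omega) hd1).trans hcost)
    omega

end ParityAutomatonWithCosts

/-! ### Choices of Player O, and pumping -/

namespace ParityAutomatonWithCosts

variable {Q AlphI AlphO : Type*} (A : ParityAutomatonWithCosts Q (AlphI × AlphO))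

/-- The first states and the records of the infixes that Player O can obtain when Player I has
picked `x`. -/
def choices (x : List AlphI) : Set (Q × InfixRecord Q) :=
  {p | ∃ y : List AlphO, y.length = x.length ∧ A.record p.1 (x.zip y) = p.2}

/-- A record contains the last state, so the record of a longer infix is a fold starting from the
record of its prefix. -/
theorem choices_append_congr {x x' : List AlphI} (h : A.choices x = A.choices x')
    (z : List AlphI) : A.choices (x ++ z) = A.choices (x' ++ z) := by
  have key : ∀ x x' : List AlphI, A.choices x = A.choices x' →
      A.choices (x ++ z) ⊆ A.choices (x' ++ z) := by
    rintro x x' h ⟨q, r⟩ ⟨y, hy, hr⟩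
    rw [List.length_append] at hy
    have hlen : (y.take x.length).length = x.length := by simp; omega
    have hmem : (q, A.record q (x.zip (y.take x.length))) ∈ A.choices x := ⟨_, hlen, rfl⟩
    rw [h] at hmem
    obtain ⟨y', hy', hr'⟩ := hmem
    refine ⟨y' ++ y.drop x.length, by simp [hy']; omega, ?_⟩
    rw [← List.take_append_drop x.length y, List.zip_append hlen.symm, record,
      List.foldl_append] at hr
    rw [List.zip_append hy'.symm, record, List.foldl_append]
    have hr'' : A.record q (x'.zip y') = A.record q (x.zip (y.take x.length)) := hr'
    change List.foldl A.recordStep (A.record q (x'.zip y')) _ = r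
    rw [hr'']
    exact hr
  exact (key x x' h).antisymm (key x' x h.symm)

theorem card_set_prod_infixRecord [Finite Q] :
    Nat.card (Set (Q × InfixRecord Q)) = 2 ^ (2 * Nat.card Q ^ 4) := by
  have e : Nat.card (InfixRecord Q) = Nat.card (Q × Q × Q × Bool) :=
    Nat.card_congr InfixRecord.equivProd
  have : Finite (InfixRecord Q) := Finite.of_equiv _ InfixRecord.equivProd.symm
  have := Fintype.ofFinite (Q × InfixRecord Q)
  rw [Nat.card_eq_fintype_card, Fintype.card_set, ← Nat.card_eq_fintype_card, Nat.card_prod, e]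
  simp only [Nat.card_prod, Nat.card_eq_fintype_card (α := Bool), Fintype.card_bool]
  congr 1
  ring

/-- By pigeonhole, two prefixes of `x` have the same choices; repeating the segment between them
lengthens `x`. -/
theorem exists_longer_choices_eq [Finite Q] (x : List AlphI)
    (hx : 2 ^ (2 * Nat.card Q ^ 4) ≤ x.length) :
    ∃ x', A.choices x' = A.choices x ∧ x.length < x'.length := by
  have : Finite (InfixRecord Q) := Finite.of_equiv _ InfixRecord.equivProd.symm
  have hnot : ¬ Function.Injective fun i : Fin (x.length + 1) => A.choices (x.take i) := by
    intro hinj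
    have := Nat.card_le_card_of_injective _ hinj
    rw [card_set_prod_infixRecord, Nat.card_fin] at this
    omega
  have key : ∀ i j, i < j → j ≤ x.length → A.choices (x.take i) = A.choices (x.take j) →
      ∃ x', A.choices x' = A.choices x ∧ x.length < x'.length := fun i j hij hj h =>
    ⟨x.take j ++ x.drop i, by rw [← A.choices_append_congr h, List.take_append_drop],
      by simp; omega⟩
  simp only [Function.Injective, not_forall] at hnot
  obtain ⟨i, j, h, hne⟩ := hnot
  have hi := i.2
  have hj := j.2
  rcases Nat.lt_or_gt_of_ne (fun e => hne (Fin.ext e)) with hij | hij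
  · exact key i j hij (by omega) h
  · exact key j i hij (by omega) h.symm

theorem exists_long_choices_eq [Finite Q] (x : List AlphI)
    (hx : 2 ^ (2 * Nat.card Q ^ 4) ≤ x.length) (l : ℕ) :
    ∃ x', A.choices x' = A.choices x ∧ x.length + l ≤ x'.length := by
  induction l with
  | zero => exact ⟨x, rfl, le_rfl⟩
  | succ l ih =>
    obtain ⟨x', h, hl⟩ := ih
    obtain ⟨x'', h', hl'⟩ := A.exists_longer_choices_eq x' (by omega)
    exact ⟨x'', h'.trans h, by omega⟩

end ParityAutomatonWithCosts

/-! ### Simulation of an arbitrary delay by two blocks of lookahead -/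

namespace DelayGame

variable {Q AlphI AlphO : Type*}

/-- A stage of the simulation of a play by one whose blocks have a fixed length. -/
structure Stage (Q AlphI AlphO : Type*) where
  /-- where the current block starts -/
  start : ℕ
  /-- the letters of Player I up to the end of the current block -/
  input : List AlphI
  /-- the letters of Player O before the current block of the simulating play -/
  output : List AlphO
  /-- the state before the current block -/
  state : Q

namespace Stage

variable (A : ParityAutomatonWithCosts Q (AlphI × AlphO)) (f : DelayFunction) (N : ℕ)
  (g : (ℕ → AlphO) → ℕ → AlphI) (d : AlphO) (v v' : ℕ → AlphO)

/-- Block `i` of Player I in the simulating play, where Player O has picked `y`. -/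
def block (y : List AlphO) (i : ℕ) : List AlphI :=
  (List.range N).map fun l => g (extendWord d y) (i * N + l)

/-- A word with the same choices as `x` that continues a word of length `l` beyond the letters
that Player I has to pick before letter `l` of Player O is known. -/
noncomputable def longWord (x : List AlphI) (l : ℕ) : List AlphI :=
  Classical.epsilon fun x' => A.choices x' = A.choices x ∧ f.total l ≤ l + x'.length

/-- The current block of the simulated play. -/
def currentBlock (S : Stage Q AlphI AlphO) : List (AlphI × AlphO) :=
  (S.input.drop S.start).zip
    ((List.range (S.input.length - S.start)).map fun l => v (S.start + l))

/-- The answer of Player O to the block `x` of the simulating play. -/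
noncomputable def response (S : Stage Q AlphI AlphO) (x : List AlphI) : List AlphO :=
  Classical.epsilon fun y => y.length = x.length ∧
    A.record S.state (x.zip y) = A.record S.state (S.currentBlock v)

/-- The stages of the simulation. -/
noncomputable def stage : ℕ → Stage Q AlphI AlphO
  | 0 => ⟨0, longWord A f (block N g d [] 0) 0, [], A.init⟩
  | i + 1 =>
    let S := stage i
    { start := S.input.length
      input := S.input ++ longWord A f (block N g d S.output (i + 1)) S.input.length
      output := S.output ++ S.response A v (block N g d S.output i)
      state := (A.record S.state (S.currentBlock v)).last }

variable {A f N g d v v'}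

theorem length_block (y : List AlphO) (i : ℕ) : (block N g d y i).length = N := by simp [block]

theorem longWord_spec [Finite Q] (hN : 2 ^ (2 * Nat.card Q ^ 4) ≤ N) {x : List AlphI}
    (hx : x.length = N) (l : ℕ) :
    A.choices (longWord A f x l) = A.choices x ∧ f.total l ≤ l + (longWord A f x l).length := by
  refine Classical.epsilon_spec
    (p := fun x' => A.choices x' = A.choices x ∧ f.total l ≤ l + x'.length) ?_
  obtain ⟨x', h, h'⟩ := A.exists_long_choices_eq x (by omega) (f.total l)
  exact ⟨x', h, by omega⟩

theorem length_currentBlock {S : Stage Q AlphI AlphO} :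
    ((List.range (S.input.length - S.start)).map fun l => v (S.start + l)).length =
      (S.input.drop S.start).length := by simp

theorem response_spec {S : Stage Q AlphI AlphO} {x : List AlphI}
    (h : A.choices (S.input.drop S.start) = A.choices x) :
    (S.response A v x).length = x.length ∧
      A.record S.state (x.zip (S.response A v x)) = A.record S.state (S.currentBlock v) := by
  refine Classical.epsilon_spec (p := fun y => y.length = x.length ∧
    A.record S.state (x.zip y) = A.record S.state (S.currentBlock v)) ?_
  have hmem : (S.state, A.record S.state (S.currentBlock v)) ∈ A.choices (S.input.drop S.start) :=
    ⟨_, length_currentBlock, rfl⟩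
  rw [h] at hmem
  exact hmem

theorem extendWord_append {y z : List AlphO} {i : ℕ} (h : i < y.length) :
    extendWord d (y ++ z) i = extendWord d y i := by
  simp [extendWord, List.getElem?_append_left h]

theorem extendWord_eq_of_prefix {α : Type*} {d : α} {u : ℕ → List α}
    (hu : ∀ i, u i <+: u (i + 1)) {i j m : ℕ} (hi : m < (u i).length) (hj : m < (u j).length) :
    extendWord d (u i) m = extendWord d (u j) m := by
  have key : ∀ i j, i ≤ j → m < (u i).length → extendWord d (u i) m = extendWord d (u j) m := by
    intro i j hij hi
    have hp : u i <+: u j := by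
      induction j, hij using Nat.le_induction with
      | base => exact List.prefix_rfl
      | succ j _ ih => exact ih.trans (hu j)
    obtain ⟨z, hz⟩ := hp
    rw [← hz]
    simp [extendWord, List.getElem?_append_left hi]
  rcases le_total i j with h | h
  · exact key i j h hi
  · exact (key j i h hj).symm

theorem drop_eq_map_extendWord {α : Type*} (d : α) (x : List α) (s : ℕ) :
    x.drop s = (List.range (x.length - s)).map fun l => extendWord d x (s + l) := by
  refine List.ext_getElem (by simp) fun l h _ => ?_
  have : s + l < x.length := by simp at h; omega
  simp [extendWord, List.getElem?_eq_getElem this]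

/-- The first `i * N` letters of Player O determine both block `i` and block `i + 1`; this is where
the factor 2 in the lookahead is used. -/
theorem block_congr {f₀ : DelayFunction} (hg : IsCausal f₀ g)
    (hf₀ : ∀ j, f₀.total j = 2 * N + j) {u u' : ℕ → AlphO} {i l : ℕ}
    (h : ∀ m < i * N, u m = u' m) (hl : l < 2 * N) : g u (i * N + l) = g u' (i * N + l) :=
  hg _ _ (i * N) _ h (by rw [hf₀]; omega)

/-- What holds at stage `i`. -/
structure Valid (A : ParityAutomatonWithCosts Q (AlphI × AlphO)) (f : DelayFunction) (N : ℕ)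
    (g : (ℕ → AlphO) → ℕ → AlphI) (d : AlphO) (i : ℕ) (S : Stage Q AlphI AlphO) : Prop where
  start_lt : S.start < S.input.length
  total_le : f.total S.start ≤ S.input.length
  length_output : S.output.length = i * N
  choices_eq : A.choices (S.input.drop S.start) = A.choices (block N g d S.output i)

theorem valid_stage [Finite Q] (hN : 2 ^ (2 * Nat.card Q ^ 4) ≤ N) {f₀ : DelayFunction}
    (hg : IsCausal f₀ g) (hf₀ : ∀ j, f₀.total j = 2 * N + j) (v : ℕ → AlphO) (i : ℕ) :
    Valid A f N g d i (stage A f N g d v i) := by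
  induction i with
  | zero =>
    have h := longWord_spec (A := A) (f := f) hN (length_block (g := g) (d := d) [] 0) 0
    have h0 := f.lt_total 0
    exact ⟨by simp only [stage]; omega, by simp only [stage]; omega, by simp [stage],
      by simpa [stage] using h.1⟩
  | succ i ih =>
    obtain ⟨-, -, h3, h4⟩ := ih
    simp only [stage]
    set S := stage A f N g d v i
    have h := longWord_spec (A := A) (f := f) hN (length_block (g := g) (d := d) S.output (i + 1))
      S.input.length
    have h0 := f.lt_total S.input.length
    refine ⟨?_, ?_, ?_, ?_⟩
    · simp only [List.length_append]; omega
    · simp only [List.length_append]; omega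
    · rw [List.length_append, h3, (response_spec h4).1, length_block, Nat.succ_mul]
    · simp only [List.drop_left, h.1]
      congr 1
      refine List.map_congr_left fun l hl => ?_
      rw [List.mem_range] at hl
      rw [Nat.succ_mul, add_assoc]
      refine block_congr hg hf₀ (fun m hm => (extendWord_append ?_).symm) (by omega)
      omega

/-- A stage uses Player O's letters on completed blocks only, not on its own current block. -/
theorem stage_congr {i : ℕ} (hS : ∀ i, (stage A f N g d v i).start ≤
      (stage A f N g d v i).input.length)
    (h : ∀ l < (stage A f N g d v i).start, v l = v' l) :
    stage A f N g d v i = stage A f N g d v' i := by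
  induction i with
  | zero => rfl
  | succ i ih =>
    have hi := hS i
    simp only [stage] at h ⊢
    rw [← ih fun l hl => h l (by omega)]
    set S := stage A f N g d v i
    have hb : S.currentBlock v = S.currentBlock v' := by
      unfold currentBlock
      congr 1
      refine List.map_congr_left fun l hl => h _ ?_
      rw [List.mem_range] at hl
      omega
    simp only [response, hb]

end Stage

open Stage

theorem IsCausal.playerIWins_of_long [Finite Q] {A : ParityAutomatonWithCosts Q (AlphI × AlphO)}
    {f₀ f : DelayFunction} {N : ℕ} {g : (ℕ → AlphO) → ℕ → AlphI} (d : AlphO)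
    (hN : 2 ^ (2 * Nat.card Q ^ 4) ≤ N) (hg : IsCausal f₀ g)
    (hf₀ : ∀ j, f₀.total j = 2 * N + j) (hL : ∀ v, (fun m => (g v m, v m)) ∉ A.language) :
    PlayerIWins f A.language := by
  have hNpos : 0 < N := lt_of_lt_of_le (by positivity) hN
  let e : AlphI := g (fun _ => d) 0
  let S := stage A f N g d
  have hS : ∀ v i, Valid A f N g d i (S v i) := valid_stage hN hg hf₀
  have hstart : ∀ v i, (S v (i + 1)).start = (S v i).input.length := fun v i => rfl
  have hmono : ∀ v, StrictMono fun i => (S v i).start := fun v =>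
    strictMono_nat_of_lt_succ fun i => by rw [hstart]; exact (hS v i).start_lt
  have hlt : ∀ v i, i < (S v i).input.length := fun v i =>
    lt_of_le_of_lt (hmono v).le_apply (hS v i).start_lt
  have hin : ∀ v i, (S v i).input <+: (S v (i + 1)).input := fun v i => List.prefix_append _ _
  have hout : ∀ v i, (S v i).output <+: (S v (i + 1)).output := fun v i => List.prefix_append _ _
  -- Stage `m` already has more than `m` input letters, since block starts strictly increase.
  let g' : (ℕ → AlphO) → ℕ → AlphI := fun v m => extendWord e (S v m).input m
  have hg' : ∀ v i m, m < (S v i).input.length → g' v m = extendWord e (S v i).input m :=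
    fun v i m hm => extendWord_eq_of_prefix (hin v) (hlt v m) hm
  refine IsCausal.playerIWins (g := g') d (fun v v' j m hv hm => ?_) fun v hmem => ?_
  · obtain ⟨i, hi, hi'⟩ : ∃ i, m < (S v i).input.length ∧ (S v i).input = (S v' i).input := by
      have hex : ∃ i, m < (S v i).input.length := ⟨m, hlt v m⟩
      refine ⟨Nat.find hex, Nat.find_spec hex, ?_⟩
      rcases hf : Nat.find hex with _ | i
      · rfl
      · have hle := Nat.find_min hex (m := i) (by omega)
        -- The total at this start is at most the input length of stage `i`, hence at most `m`,
        -- which is below the total at `j`. So stage `i`, which fixes the input of stage `i + 1`, is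
        -- known in time.
        have hj : (S v i).start < j := by
          refine f.total_strictMono.lt_iff_lt.mp ?_
          have := (hS v i).total_le
          omega
        have hc : S v i = S v' i := stage_congr (fun i => (hS v i).start_lt.le)
          fun l hl => hv l (lt_trans hl hj)
        change (S v i).input ++ longWord A f (block N g d (S v i).output (i + 1))
            (S v i).input.length =
          (S v' i).input ++ longWord A f (block N g d (S v' i).output (i + 1))
            (S v' i).input.length
        rw [hc]
    rw [hg' v i m hi, hg' v' i m (hi' ▸ hi), hi']
  -- The limit of the translated answers: stage `m + 1` has `(m + 1) * N > m` output letters.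
  · let u : ℕ → AlphO := fun m => extendWord d (S v (m + 1)).output m
    have hu : ∀ i m, m < i * N → u m = extendWord d (S v i).output m := fun i m hm => by
      refine extendWord_eq_of_prefix (hout v) ?_ ?_
      · rw [(hS v (m + 1)).length_output]
        exact lt_of_lt_of_le (Nat.lt_succ_self m) (Nat.le_mul_of_pos_right _ hNpos)
      · rwa [(hS v i).length_output]
    have hreal : ∀ i, ParityAutomatonWithCosts.infixWord (fun m => (g' v m, v m)) (S v i).start
        ((S v (i + 1)).start - (S v i).start) = (S v i).currentBlock v := fun i => by
      rw [currentBlock, drop_eq_map_extendWord e, List.zip_map', hstart]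
      refine List.map_congr_left fun l hl => ?_
      rw [List.mem_range] at hl
      exact Prod.ext (hg' v i _ (by omega)) rfl
    have hsim : ∀ i, ParityAutomatonWithCosts.infixWord (fun m => (g u m, u m)) (i * N) N =
        (block N g d (S v i).output i).zip
          ((S v i).response A v (block N g d (S v i).output i)) := fun i => by
      have hlen := (response_spec (v := v) (hS v i).choices_eq).1
      have hr : (S v i).response A v (block N g d (S v i).output i) =
          (List.range N).map fun l => u (i * N + l) := by
        refine List.ext_getElem (by rw [hlen, length_block]; simp) fun l h _ => ?_
        rw [hlen, length_block] at h
        rw [List.getElem_map, List.getElem_range, hu (i + 1) _ (by rw [Nat.succ_mul]; omega)]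
        change _ = extendWord d ((S v i).output ++ _) _
        have hl := (hS v i).length_output
        rw [extendWord, List.getD_eq_getElem?_getD, List.getElem?_append_right (by omega), hl,
          Nat.add_sub_cancel_left, List.getElem?_eq_getElem (by rwa [hlen, length_block])]
        rfl
      rw [hr, block, List.zip_map']
      refine List.map_congr_left fun l hl => ?_
      rw [List.mem_range] at hl
      exact Prod.ext (block_congr hg hf₀ (hu i) (by omega)) rfl
    have hrec : ∀ i, A.record (S v i).state (ParityAutomatonWithCosts.infixWord
          (fun m => (g u m, u m)) (i * N) N) =
        A.record (S v i).state ((S v i).currentBlock v) := fun i => by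
      rw [hsim]
      exact (response_spec (hS v i).choices_eq).2
    have hst : ∀ i, A.state (fun m => (g' v m, v m)) (S v i).start = (S v i).state ∧
        A.state (fun m => (g u m, u m)) (i * N) = (S v i).state := fun i => by
      induction i with
      | zero => exact ⟨rfl, by rw [Nat.zero_mul]; rfl⟩
      | succ i ih =>
        have hlast : (S v (i + 1)).state =
          (A.record (S v i).state ((S v i).currentBlock v)).last := rfl
        have h1 := A.last_runRecord (fun m => (g' v m, v m)) (S v i).start
          ((S v (i + 1)).start - (S v i).start)
        have h2 := A.last_runRecord (fun m => (g u m, u m)) (i * N) N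
        rw [Nat.add_sub_cancel' (hmono v (Nat.lt_succ_self i)).le,
          ParityAutomatonWithCosts.runRecord, ih.1, hreal] at h1
        rw [ParityAutomatonWithCosts.runRecord, ih.2, hrec] at h2
        exact ⟨h1.symm.trans hlast.symm, by rw [Nat.succ_mul, ← h2, hlast]⟩
    refine hL u (A.mem_language_of_runRecord_eq hNpos (hmono v) (fun i => ?_) hmem)
    simp only [ParityAutomatonWithCosts.runRecord, (hst i).1, (hst i).2, hreal, hrec]

end DelayGame

theorem mainTheorem2 {Q AlphI AlphO : Type*} [Finite Q]
    (A : ParityAutomatonWithCosts Q (AlphI × AlphO)) (n k : ℕ)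
    (hn : A.numStates = n) (hk : A.numColors = k)
    (f : DelayFunction) (hf : f.IsConstant) (hf0 : f.toFun 0 = 2 ^ (2 * n ^ 4 * k ^ 2 + 1)) :
    DelayGame.PlayerIWins f A.language ↔
      ∀ f' : DelayFunction, DelayGame.PlayerIWins f' A.language := by
  refine ⟨fun h f' => ?_, fun h => h f⟩
  rcases isEmpty_or_nonempty AlphO with _ | ⟨⟨d⟩⟩
  · obtain ⟨τ, -⟩ := h
    have hpos : 0 < (τ.toFun []).length := by rw [τ.length_toFun]; exact f.pos _
    -- Without letters for Player O there are no plays; a letter for Player I comes from the first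
    -- move of `τ`.
    exact DelayGame.playerIWins_of_isEmpty (τ.toFun [])[0]
  · obtain ⟨g, hg, hL⟩ := h.exists_isCausal
    have hkpos : 0 < k := by
      rw [← hk]
      exact (Set.ncard_pos (Set.finite_range A.color)).mpr ⟨_, A.init, rfl⟩
    refine hg.playerIWins_of_long (N := 2 ^ (2 * n ^ 4 * k ^ 2)) d ?_ (fun j => ?_) hL
    · change Nat.card Q = n at hn
      rw [hn]
      -- Records store states instead of colors, so the factor `k ^ 2` is only needed to be
      -- positive.
      exact Nat.pow_le_pow_right two_pos (Nat.le_mul_of_pos_right _ (by positivity))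
    · rw [f.total_of_isConstant hf, hf0, pow_succ, mul_comm (2 ^ _) 2]
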